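/- Let $n\ge 1$ and consider the letters (band generators) $a_{ts}$, $n\ge t>s\ge 1$. A positive word is a finite (possibly empty) word in these letters. Two positive words are positively equivalent, written $X\doteq Y$, if one can be transformed into the other by a finite sequence of single applications, to subwords, of the relations $$a_{ts}a_{rq}=a_{rq}a_{ts}\quad\text{if }(t-r)(t-q)(s-r)(s-q)>0,$$ $$a_{ts}a_{sr}=a_{tr}a_{ts}=a_{sr}a_{tr}\quad\text{for all } n\ge t>s>r\ge 1.$$ **Theorem (Right "cancellation").** Let $n\ge t>s\ge1$ and $n\ge r>q\ge1$, and let $Xa_{ts}\doteq Ya_{rq}$ for some positive words $X,Y$. Then $X$ and $Y$ are related as follows, where in each case $Z$ denotes some positive word. (I) If $t=r$ and $s=q$, then $X\doteq Y$. (II) (i) If $t=r$ and $q<s$, then $X\doteq Za_{tq}$ and $Y\doteq Za_{sq}$ for some $Z$. (ii) If $t=r$ and $s<q$, then $X\doteq Za_{qs}$ and $Y\doteq Za_{ts}$ for some $Z$. (iii) If $t=q$, then $X\doteq Za_{rt}$ and $Y\doteq Za_{rs}$ for some $Z$. (iv) If $s=r$, then $X\doteq Za_{tq}$ and $Y\doteq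 Za_{ts}$ for some $Z$. (v) If $s=q$ and $r<t$, then $X\doteq Za_{rs}$ and $Y\doteq Za_{tr}$ for some $Z$. (vi) If $s=q$ and $t<r$, then $X\doteq Za_{rt}$ and $Y\doteq Za_{ts}$ for some $Z$. (III) If $(t-r)(t-q)(s-r)(s-q)>0$, then $X\doteq Za_{rq}$ and $Y\doteq Za_{ts}$ for some $Z$. (IV) (i) If $q<s<r<t$, then $X\doteq Za_{tq}a_{rs}$ and $Y\doteq Za_{tr}a_{sq}$ for some $Z$. (ii) If $s<q<t<r$, then $X\doteq Za_{rt}a_{qs}$ and $Y\doteq Za_{tq}a_{rs}$ for some $Z$. -/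

import Mathlib

/-- The band generator `a_{ts}` of the braid group on `n` strands, for `n ≥ t > s ≥ 1`,
as a formal letter. -/
structure BandGen (n : ℕ) where
  /-- the first (larger) subscript -/
  t : ℕ
  /-- the second (smaller) subscript -/
  s : ℕ
  one_le : 1 ≤ s
  lt : s < t
  le : t ≤ n

/-- The letter `a_{ts}`. The inequalities `1 ≤ s < t ≤ n` are found automatically. -/
def band {n : ℕ} (t s : ℕ) (h : 1 ≤ s ∧ s < t ∧ t ≤ n := by omega) : BandGen n :=
  ⟨t, s, h.1, h.2.1, h.2.2⟩

/-- Positive words in the band generators. -/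
abbrev PosWord (n : ℕ) : Type := List (BandGen n)

/-- The defining relations between positive words of length two:
`a_{ts} a_{rq} = a_{rq} a_{ts}` if `(t - r)(t - q)(s - r)(s - q) > 0`, and
`a_{ts} a_{sr} = a_{tr} a_{ts} = a_{sr} a_{tr}` for `n ≥ t > s > r ≥ 1`. -/
inductive BandRel (n : ℕ) : PosWord n → PosWord n → Prop
  | comm (t s r q : ℕ) (hts : 1 ≤ s ∧ s < t ∧ t ≤ n) (hrq : 1 ≤ q ∧ q < r ∧ r ≤ n)
      (h : 0 < ((t : ℤ) - r) * ((t : ℤ) - q) * ((s : ℤ) - r) * ((s : ℤ) - q)) :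
      BandRel n [band t s, band r q] [band r q, band t s]
  | triangle₁ (t s r : ℕ) (h : 1 ≤ r ∧ r < s ∧ s < t ∧ t ≤ n) :
      BandRel n [band t s, band s r] [band t r, band t s]
  | triangle₂ (t s r : ℕ) (h : 1 ≤ r ∧ r < s ∧ s < t ∧ t ≤ n) :
      BandRel n [band t r, band t s] [band s r, band t r]
  | triangle₃ (t s r : ℕ) (h : 1 ≤ r ∧ r < s ∧ s < t ∧ t ≤ n) :
      BandRel n [band t s, band s r] [band s r, band t r]

/-- `W'` is obtained from `W` by a single direct application of a defining relation
(in either direction) to a subword. -/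
def PosStep {n : ℕ} (W W' : PosWord n) : Prop :=
  ∃ P U V S : PosWord n, (BandRel n U V ∨ BandRel n V U) ∧
    W = P ++ U ++ S ∧ W' = P ++ V ++ S

/-- Positive equivalence: a finite chain of single applications of defining relations leads
from the first positive word to the second. -/
def PosEquiv {n : ℕ} (X Y : PosWord n) : Prop :=
  Relation.ReflTransGen PosStep X Y

infix:50 " ≐ " => PosEquiv

/-! Read backwards, the claim is a left cancellation law: if `aX` and `bY` are equivalent, both are
right multiples of one common multiple of `a` and `b`, whose cofactors are given by `rightCompl`.
This is Garside's argument in Dehornoy's form. By induction on length, and then on the chain of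
relations from `aX` to `bY`, one passes through an intermediate letter `c`. Cancellation for shorter
words then reduces everything to a cube condition on the three letters `a`, `b`, `c` (`exists_cube`,
`cancelsBelow`). The cube condition depends only on the order of at most six subscripts. A finite
computation with subscripts below 6 (`cubeCheck_six`) therefore settles it for all subscripts, by
transport along a strictly monotone map. Dropping the bound `n` makes this transport possible; it is
restored at the end because the relations introduce no new subscripts. -/

/-! ### Reversed words, complements and the computable cube condition. -/

/-- Words in unbounded band generators, `(t, s)` standing for `a_{ts}`, read from right to left. -/
abbrev RawWord : Type := List (ℕ × ℕ)

/-- The reversed defining relations, without an upper bound on the subscripts. -/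
inductive RawRel : RawWord → RawWord → Prop
  | comm (t s r q : ℕ) (hts : s < t) (hrq : q < r)
      (h : t < q ∨ r < s ∨ (s < q ∧ r < t) ∨ (q < s ∧ t < r)) :
      RawRel [(t, s), (r, q)] [(r, q), (t, s)]
  | triangle₁ (t s r : ℕ) (h : r < s ∧ s < t) : RawRel [(s, r), (t, s)] [(t, s), (t, r)]
  | triangle₂ (t s r : ℕ) (h : r < s ∧ s < t) : RawRel [(t, s), (t, r)] [(t, r), (s, r)]
  | triangle₃ (t s r : ℕ) (h : r < s ∧ s < t) : RawRel [(s, r), (t, s)] [(t, r), (s, r)]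

/-- One application of a relation, in either direction, to a subword. -/
def RawStep (W W' : RawWord) : Prop :=
  ∃ P U V S : RawWord, (RawRel U V ∨ RawRel V U) ∧ W = P ++ U ++ S ∧ W' = P ++ V ++ S

/-- The congruence generated by the relations. -/
def RawEquiv (W W' : RawWord) : Prop := Relation.ReflTransGen RawStep W W'

/-- The right complement of `a` with respect to `b`: the word that completes `a` to the least
common multiple of `a` and `b`. -/
def rightCompl (a b : ℕ × ℕ) : RawWord :=
  if a.1 = b.1 then
    if a.2 = b.2 then [] else if b.2 < a.2 then [(a.1, b.2)] else [(b.2, a.2)]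
  else if a.1 = b.2 then [(b.1, a.1)]
  else if a.2 = b.1 then [(a.1, b.2)]
  else if a.2 = b.2 then
    if b.1 < a.1 then [(b.1, a.2)] else [(b.1, a.1)]
  else if b.2 < a.2 ∧ a.2 < b.1 ∧ b.1 < a.1 then [(b.1, a.2), (a.1, b.2)]
  else if a.2 < b.2 ∧ b.2 < a.1 ∧ a.1 < b.1 then [(b.2, a.2), (b.1, a.1)]
  else [b]

/-- Word reversing: the pair of words completing `u` and `v` to a least common multiple, if it is
found within the given number of steps. -/
def reversing : ℕ → RawWord → RawWord → Option (RawWord × RawWord)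
  | 0, _, _ => none
  | _ + 1, [], v => some (v, [])
  | _ + 1, x :: u, [] => some ([], x :: u)
  | k + 1, x :: u, y :: v =>
    if x.2 < x.1 ∧ y.2 < y.1 then
      (reversing k u (rightCompl x y)).bind fun p =>
        (reversing k v (rightCompl y x ++ p.2)).map fun q => (p.1 ++ q.2, q.1)
    else none

/-- Two results of word reversing are divisions without remainder, with equivalent quotients. -/
def sameQuotient : Option (RawWord × RawWord) → Option (RawWord × RawWord) → Bool
  | some ([], D), some ([], D') => reversing 12 D D' == some ([], [])
  | _, _ => false

/-- The cube condition for `a`, `b` and the intermediate letter `c`, as checked by reversing. -/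
def cubeCheck (a b c : ℕ × ℕ) : Bool :=
  match reversing 12 (rightCompl c a) (rightCompl c b) with
  | none => false
  | some p =>
    sameQuotient (reversing 12 (rightCompl a c ++ p.1) (rightCompl a b))
      (reversing 12 (rightCompl b c ++ p.2) (rightCompl b a))

/-- Three letters carry at most six subscripts, so every order pattern occurs here. The evaluation
also confirms that 12 steps of reversing suffice. -/
theorem cubeCheck_six : ∀ i < 6, ∀ j < i, ∀ k < 6, ∀ l < k, ∀ x < 6, ∀ y < x,
    cubeCheck (i, j) (k, l) (x, y) = true := by
  decide +kernel

namespace RawEquiv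

theorem refl (W : RawWord) : RawEquiv W W := Relation.ReflTransGen.refl

theorem trans {U V W : RawWord} (h : RawEquiv U V) (h' : RawEquiv V W) : RawEquiv U W :=
  Relation.ReflTransGen.trans h h'

theorem symm {U V : RawWord} (h : RawEquiv U V) : RawEquiv V U := by
  induction h with
  | refl => exact refl _
  | tail _ h ih =>
    obtain ⟨P, U, V, S, h, rfl, rfl⟩ := h
    exact Relation.ReflTransGen.head ⟨P, V, U, S, h.symm, rfl, rfl⟩ ih

theorem of_rel {U V : RawWord} (h : RawRel U V) : RawEquiv U V :=
  Relation.ReflTransGen.single ⟨[], U, V, [], Or.inl h, by simp, by simp⟩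

theorem append_left {U V : RawWord} (W : RawWord) (h : RawEquiv U V) :
    RawEquiv (W ++ U) (W ++ V) := by
  refine Relation.ReflTransGen.lift (W ++ ·) ?_ U V h
  rintro _ _ ⟨P, U, V, S, h, rfl, rfl⟩
  exact ⟨W ++ P, U, V, S, h, by simp, by simp⟩

theorem append_right {U V : RawWord} (W : RawWord) (h : RawEquiv U V) :
    RawEquiv (U ++ W) (V ++ W) := by
  refine Relation.ReflTransGen.lift (· ++ W) ?_ U V h
  rintro _ _ ⟨P, U, V, S, h, rfl, rfl⟩
  exact ⟨P, U, V, S ++ W, h, by simp, by simp⟩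

theorem length_eq {U V : RawWord} (h : RawEquiv U V) : U.length = V.length := by
  induction h with
  | refl => rfl
  | tail _ h ih =>
    obtain ⟨P, U, V, S, h, rfl, rfl⟩ := h
    rw [ih]
    rcases h with h | h <;> cases h <;> simp

end RawEquiv

/-! ### Complements and soundness of reversing. -/

/-- Both complements lead to the same multiple. -/
theorem rawEquiv_cons_rightCompl (a b : ℕ × ℕ) (ha : a.2 < a.1) (hb : b.2 < b.1) :
    RawEquiv (a :: rightCompl a b) (b :: rightCompl b a) := by
  wlog h : b.1 < a.1 ∨ (b.1 = a.1 ∧ b.2 ≤ a.2) generalizing a b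
  · exact (this b a hb ha (by omega)).symm
  obtain ⟨t, s⟩ := a
  obtain ⟨r, q⟩ := b
  simp only at ha hb h
  rcases h with h | ⟨rfl, h⟩
  · rcases lt_trichotomy s q with hsq | rfl | hsq
    · rw [show rightCompl (t, s) (r, q) = [(r, q)] by grind [rightCompl],
        show rightCompl (r, q) (t, s) = [(t, s)] by grind [rightCompl]]
      exact .of_rel (.comm t s r q ha hb (by omega))
    · rw [show rightCompl (t, s) (r, s) = [(r, s)] by grind [rightCompl],
        show rightCompl (r, s) (t, s) = [(t, r)] by grind [rightCompl]]
      exact .symm (.of_rel (.triangle₃ t r s ⟨hb, h⟩))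
    · rcases lt_trichotomy s r with hsr | rfl | hsr
      -- Crossing chords: no single relation applies, and the two multiples are joined by three
      -- triangle relations.
      · rw [show rightCompl (t, s) (r, q) = [(r, s), (t, q)] by grind [rightCompl],
          show rightCompl (r, q) (t, s) = [(s, q), (t, r)] by grind [rightCompl]]
        have e₁ := RawEquiv.of_rel (.triangle₃ t r s ⟨hsr, h⟩)
        have e₂ := RawEquiv.of_rel (.triangle₁ t r q ⟨hb, h⟩)
        have e₃ := RawEquiv.of_rel (.triangle₂ r s q ⟨hsq, hsr⟩)
        exact (e₁.symm.append_right [(t, q)]).trans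
          ((e₂.symm.append_left [(r, s)]).trans (e₃.append_right [(t, r)]))
      · rw [show rightCompl (t, s) (s, q) = [(t, q)] by grind [rightCompl],
          show rightCompl (s, q) (t, s) = [(t, s)] by grind [rightCompl]]
        exact .symm (.of_rel (.triangle₁ t s q ⟨hb, h⟩))
      · rw [show rightCompl (t, s) (r, q) = [(r, q)] by grind [rightCompl],
          show rightCompl (r, q) (t, s) = [(t, s)] by grind [rightCompl]]
        exact .of_rel (.comm t s r q ha hb (by omega))
  · rcases h.eq_or_lt with rfl | h
    · exact .refl _
    · rw [show rightCompl (r, s) (r, q) = [(r, q)] by grind [rightCompl],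
        show rightCompl (r, q) (r, s) = [(s, q)] by grind [rightCompl]]
      exact .of_rel (.triangle₂ r s q ⟨h, ha⟩)

/-- Related words of length two that start with `c` and `b` are completed by complements. -/
theorem RawRel.eq_rightCompl {c b : ℕ × ℕ} {U V : RawWord} (h : RawRel (c :: U) (b :: V)) :
    c.2 < c.1 ∧ b.2 < b.1 ∧ U = rightCompl c b ∧ V = rightCompl b c := by
  cases h <;> simp [rightCompl] <;> grind

theorem reversing_sound (k : ℕ) : ∀ (u v p q : RawWord), reversing k u v = some (p, q) →
    RawEquiv (u ++ p) (v ++ q) := by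
  induction k with
  | zero => intro u v p q h; simp [reversing] at h
  | succ k ih =>
    intro u v p q h
    match u, v with
    | [], v =>
      simp only [reversing, Option.some.injEq, Prod.mk.injEq] at h
      obtain ⟨rfl, rfl⟩ := h
      simpa using RawEquiv.refl _
    | x :: u, [] =>
      simp only [reversing, Option.some.injEq, Prod.mk.injEq] at h
      obtain ⟨rfl, rfl⟩ := h
      simpa using RawEquiv.refl _
    | x :: u, y :: v =>
      simp only [reversing, Option.ite_none_right_eq_some, Option.bind_eq_some_iff,
        Option.map_eq_some_iff, Prod.exists, Prod.mk.injEq] at h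
      obtain ⟨⟨hx, hy⟩, p₁, q₁, h₁, p₂, q₂, h₂, rfl, rfl⟩ := h
      have e₁ := (ih _ _ _ _ h₁).append_right q₂ |>.append_left [x]
      have e₂ := (ih _ _ _ _ h₂).append_left [y]
      have e₃ := (rawEquiv_cons_rightCompl x y hx hy).append_right (q₁ ++ q₂)
      simp only [List.append_assoc, List.cons_append, List.nil_append] at e₁ e₂ e₃ ⊢
      exact e₁.trans (e₃.trans e₂.symm)

/-! ### Cancellation for short words and completeness of reversing. -/

/-- Left cancellation up to complements holds for words of length less than `m`. -/
def CancelsBelow (m : ℕ) : Prop :=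
  ∀ (a b : ℕ × ℕ) (X Y : RawWord), X.length < m → a.2 < a.1 → b.2 < b.1 →
    RawEquiv (a :: X) (b :: Y) →
    ∃ Z, RawEquiv X (rightCompl a b ++ Z) ∧ RawEquiv Y (rightCompl b a ++ Z)

/-- Converse to `reversing_sound`: the multiple found by reversing divides every common multiple.
Cancellation is applied only to tails after a first letter, so total length `m` is still allowed. -/
theorem CancelsBelow.reversing_complete {m : ℕ} (H : CancelsBelow m) (k : ℕ) :
    ∀ (u v p q Z Z' : RawWord), reversing k u v = some (p, q) → (u ++ Z).length ≤ m →
    RawEquiv (u ++ Z) (v ++ Z') → ∃ T, RawEquiv Z (p ++ T) ∧ RawEquiv Z' (q ++ T) := by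
  induction k with
  | zero => intro u v p q _ _ h; simp [reversing] at h
  | succ k ih =>
    intro u v p q Z Z' h hm e
    match u, v with
    | [], v =>
      simp only [reversing, Option.some.injEq, Prod.mk.injEq] at h
      obtain ⟨rfl, rfl⟩ := h
      exact ⟨Z', e, RawEquiv.refl _⟩
    | x :: u, [] =>
      simp only [reversing, Option.some.injEq, Prod.mk.injEq] at h
      obtain ⟨rfl, rfl⟩ := h
      exact ⟨Z, RawEquiv.refl _, e.symm⟩
    | x :: u, y :: v =>
      simp only [reversing, Option.ite_none_right_eq_some, Option.bind_eq_some_iff,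
        Option.map_eq_some_iff, Prod.exists, Prod.mk.injEq] at h
      obtain ⟨⟨hx, hy⟩, p₁, q₁, h₁, p₂, q₂, h₂, rfl, rfl⟩ := h
      have hl := e.length_eq
      simp only [List.length_append, List.length_cons] at hm hl
      obtain ⟨T, hT, hT'⟩ := H x y (u ++ Z) (v ++ Z') (by simp; omega) hx hy e
      obtain ⟨T₁, hZ, hT₁⟩ := ih _ _ _ _ Z T h₁ (by simp; omega) hT
      have e₂ := hT'.trans (hT₁.append_left _)
      rw [← List.append_assoc] at e₂
      obtain ⟨T₂, hZ', hT₂⟩ := ih _ _ _ _ Z' T₁ h₂ (by simp; omega) e₂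
      refine ⟨T₂, ?_, hZ'⟩
      simpa using hZ.trans (hT₂.append_left _)

/-! ### The cube condition for arbitrary subscripts. -/

theorem rightCompl_map {f : ℕ → ℕ} (hf : StrictMono f) (a b : ℕ × ℕ) :
    rightCompl (a.map f f) (b.map f f) = (rightCompl a b).map (Prod.map f f) := by
  simp only [rightCompl, Prod.map_fst, Prod.map_snd, hf.lt_iff_lt, hf.injective.eq_iff]
  split_ifs <;> rfl

/-- Reversing only compares subscripts, so it commutes with order-preserving relabelling. -/
theorem reversing_map {f : ℕ → ℕ} (hf : StrictMono f) (k : ℕ) : ∀ u v : RawWord,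
    reversing k (u.map (Prod.map f f)) (v.map (Prod.map f f)) =
      (reversing k u v).map (Prod.map (List.map (Prod.map f f)) (List.map (Prod.map f f))) := by
  induction k with
  | zero => intro u v; rfl
  | succ k ih =>
    intro u v
    match u, v with
    | [], v => rfl
    | x :: u, [] => rfl
    | x :: u, y :: v =>
      simp only [reversing, List.map_cons, Prod.map_fst, Prod.map_snd, hf.lt_iff_lt,
        rightCompl_map hf, ih]
      split_ifs
      · cases reversing k u (rightCompl x y) with
        | none => rfl
        | some p =>
          simp only [Option.map_some, Option.bind_some, Prod.map_snd, ← List.map_append, ih]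
          cases reversing k v (rightCompl y x ++ p.2) <;> simp
      · rfl

theorem sameQuotient_map {f : ℕ → ℕ} (hf : StrictMono f) {o o' : Option (RawWord × RawWord)}
    (h : sameQuotient o o' = true) :
    sameQuotient (o.map (Prod.map (List.map (Prod.map f f)) (List.map (Prod.map f f))))
      (o'.map (Prod.map (List.map (Prod.map f f)) (List.map (Prod.map f f)))) = true := by
  rcases o with _ | ⟨_ | ⟨_, _⟩, D⟩ <;> rcases o' with _ | ⟨_ | ⟨_, _⟩, D'⟩ <;>
    simp_all [sameQuotient, reversing_map hf]

theorem cubeCheck_map {f : ℕ → ℕ} (hf : StrictMono f) (a b c : ℕ × ℕ)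
    (h : cubeCheck a b c = true) :
    cubeCheck (a.map f f) (b.map f f) (c.map f f) = true := by
  unfold cubeCheck at h ⊢
  simp only [rightCompl_map hf, reversing_map hf]
  generalize reversing 12 (rightCompl c a) (rightCompl c b) = o at h ⊢
  rcases o with _ | p
  · simp at h
  · simp only [Option.map_some, Prod.map_fst, Prod.map_snd, ← List.map_append, reversing_map hf]
    exact sameQuotient_map hf h

theorem cubeCheck_eq_true (a b c : ℕ × ℕ) (ha : a.2 < a.1) (hb : b.2 < b.1) (hc : c.2 < c.1) :
    cubeCheck a b c = true := by
  classical
  set P : Finset ℕ := {a.1, a.2, b.1, b.2, c.1, c.2} with hP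
  have hcard : P.card ≤ 6 := Finset.card_le_six
  set N := P.sup id + 1
  -- Adjoining all numbers from `N` on makes the set infinite, so that `Nat.nth Q` is strictly
  -- monotone on all of `ℕ`; the elements of `P` still come first and get indices below 6.
  let Q : ℕ → Prop := fun x => x ∈ P ∨ N ≤ x
  have hinf : {x | Q x}.Infinite := (Set.Ici_infinite N).mono fun x hx => Or.inr hx
  have hf : StrictMono (Nat.nth Q) := Nat.nth_strictMono hinf
  have key : ∀ x ∈ P, Nat.count Q x < 6 ∧ Nat.nth Q (Nat.count Q x) = x := by
    intro x hx
    refine ⟨?_, Nat.nth_count (Or.inl hx)⟩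
    rw [Nat.count_eq_card_filter_range]
    refine lt_of_lt_of_le (Finset.card_lt_card ?_) hcard
    have hxN : x < N := Nat.lt_succ_of_le (Finset.le_sup (f := id) hx)
    refine ⟨fun y hy => ?_, fun h => ?_⟩
    · rw [Finset.mem_filter, Finset.mem_range] at hy
      rcases hy.2 with h | h
      · exact h
      · omega
    · simpa using h hx
  have lt : ∀ x ∈ P, ∀ y ∈ P, x < y → Nat.count Q x < Nat.count Q y := by
    intro x hx y hy h
    rw [← (key x hx).2, ← (key y hy).2] at h
    exact hf.lt_iff_lt.1 h
  have m : ∀ d : ℕ × ℕ, d.1 ∈ P → d.2 ∈ P →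
      (Nat.count Q d.1, Nat.count Q d.2).map (Nat.nth Q) (Nat.nth Q) = d := by
    intro d h₁ h₂
    simp [key _ h₁, key _ h₂]
  have a₁ : a.1 ∈ P := by simp [hP]
  have a₂ : a.2 ∈ P := by simp [hP]
  have b₁ : b.1 ∈ P := by simp [hP]
  have b₂ : b.2 ∈ P := by simp [hP]
  have c₁ : c.1 ∈ P := by simp [hP]
  have c₂ : c.2 ∈ P := by simp [hP]
  rw [← m a a₁ a₂, ← m b b₁ b₂, ← m c c₁ c₂]
  exact cubeCheck_map hf _ _ _ (cubeCheck_six _ (key _ a₁).1 _ (lt _ a₂ _ a₁ ha)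
    _ (key _ b₁).1 _ (lt _ b₂ _ b₁ hb) _ (key _ c₁).1 _ (lt _ c₂ _ c₁ hc))

theorem exists_cube (a b c : ℕ × ℕ) (ha : a.2 < a.1) (hb : b.2 < b.1) (hc : c.2 < c.1) :
    ∃ p q D, reversing 12 (rightCompl c a) (rightCompl c b) = some (p, q) ∧
      RawEquiv (rightCompl a c ++ p) (rightCompl a b ++ D) ∧
      RawEquiv (rightCompl b c ++ q) (rightCompl b a ++ D) := by
  have h := cubeCheck_eq_true a b c ha hb hc
  unfold cubeCheck at h
  split at h
  · simp at h
  · rename_i p hp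
    unfold sameQuotient at h
    split at h
    · rename_i D D' h₁ h₂
      have h₃ := reversing_sound _ _ _ _ _ (beq_iff_eq.1 h)
      have h₁ := reversing_sound _ _ _ _ _ h₁
      have h₂ := reversing_sound _ _ _ _ _ h₂
      simp only [List.append_nil] at h₁ h₂ h₃
      exact ⟨p.1, p.2, D, hp, h₁, h₂.trans (h₃.symm.append_left _)⟩
    · simp at h

/-! ### The cancellation theorem for reversed words. -/

theorem RawStep.cons_cases {c b : ℕ × ℕ} {W Y : RawWord} (h : RawStep (c :: W) (b :: Y)) :
    (c = b ∧ RawEquiv W Y) ∨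
      (c.2 < c.1 ∧ b.2 < b.1 ∧ ∃ S, W = rightCompl c b ++ S ∧ Y = rightCompl b c ++ S) := by
  obtain ⟨P, U, V, S, h, h₁, h₂⟩ := h
  cases P with
  | cons x P =>
    simp only [List.cons_append, List.cons.injEq] at h₁ h₂
    obtain ⟨rfl, rfl⟩ := h₁
    obtain ⟨rfl, rfl⟩ := h₂
    exact Or.inl ⟨rfl, Relation.ReflTransGen.single ⟨P, U, V, S, h, rfl, rfl⟩⟩
  | nil =>
    right
    have hne : ∀ {U V : RawWord}, RawRel U V → U ≠ [] ∧ V ≠ [] := by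
      intro U V h; cases h <;> simp
    obtain ⟨hU, hV⟩ : U ≠ [] ∧ V ≠ [] := h.elim hne fun h => (hne h).symm
    obtain ⟨c', U, rfl⟩ := List.exists_cons_of_ne_nil hU
    obtain ⟨b', V, rfl⟩ := List.exists_cons_of_ne_nil hV
    simp only [List.nil_append, List.cons_append, List.cons.injEq] at h₁ h₂
    obtain ⟨rfl, rfl⟩ := h₁
    obtain ⟨rfl, rfl⟩ := h₂
    rcases h with h | h
    · obtain ⟨hc, hb, rfl, rfl⟩ := h.eq_rightCompl
      exact ⟨hc, hb, S, rfl, rfl⟩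
    · obtain ⟨hb, hc, rfl, rfl⟩ := h.eq_rightCompl
      exact ⟨hc, hb, S, rfl, rfl⟩

theorem rightCompl_self (a : ℕ × ℕ) : rightCompl a a = [] := by simp [rightCompl]

theorem cancelsBelow (m : ℕ) : CancelsBelow m := by
  induction m with
  | zero => intro _ _ _ _ h; simp at h
  | succ m H =>
    intro a b X Y hX ha hb h
    generalize hW : b :: Y = W at h
    -- Induction on the chain starting at `a :: X`; only its other end varies, and `H` handles
    -- shorter words.
    induction h generalizing b Y with
    | refl =>
      obtain ⟨rfl, rfl⟩ := List.cons.inj hW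
      exact ⟨Y, by simpa [rightCompl_self] using RawEquiv.refl _,
        by simpa [rightCompl_self] using RawEquiv.refl _⟩
    | @tail W₁ W₂ h₁ h₂ ih =>
      subst hW
      have hl := RawEquiv.length_eq h₁
      obtain ⟨c, W, rfl⟩ : ∃ c W, W₁ = c :: W := by
        cases W₁ with
        | nil => simp at hl
        | cons c W => exact ⟨c, W, rfl⟩
      rcases h₂.cons_cases with ⟨rfl, e⟩ | ⟨hc, -, S, rfl, rfl⟩
      · obtain ⟨Z, hXZ, hWZ⟩ := ih c W hb rfl
        exact ⟨Z, hXZ, e.symm.trans hWZ⟩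
      -- The last step changes the first letter from `c` to `b`. The tail after `c` is then a
      -- multiple of both complements of `c`, and the cube condition turns their common multiple
      -- into one for `a` and `b`.
      · obtain ⟨Z, hXZ, hWZ⟩ := ih c _ hc rfl
        obtain ⟨p, q, D, hpq, hD, hD'⟩ := exists_cube a b c ha hb hc
        have hl' := hWZ.length_eq
        simp only [List.length_cons, List.length_append] at hl hl'
        obtain ⟨T, hZ, hS⟩ := H.reversing_complete 12 _ _ _ _ Z S hpq
          (by simp only [List.length_append]; omega) hWZ.symm
        refine ⟨D ++ T, ?_, ?_⟩
        · have := (hZ.append_left (rightCompl a c)).trans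
            (by simpa using hD.append_right T : RawEquiv _ (rightCompl a b ++ (D ++ T)))
          exact hXZ.trans this
        · exact (hS.append_left (rightCompl b c)).trans
            (by simpa using hD'.append_right T : RawEquiv _ (rightCompl b a ++ (D ++ T)))

/-! ### Transfer between bounded positive words and reversed raw words. -/

/-- The raw letter underlying a band generator. -/
def BandGen.raw {n : ℕ} (a : BandGen n) : ℕ × ℕ := (a.t, a.s)

theorem BandGen.raw_injective {n : ℕ} : Function.Injective (BandGen.raw (n := n)) := by
  rintro ⟨t, s, _, _, _⟩ ⟨r, q, _, _, _⟩ h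
  simp only [BandGen.raw, Prod.mk.injEq] at h
  obtain ⟨rfl, rfl⟩ := h
  rfl

/-- The raw word underlying a positive word; the order of the letters is reversed. -/
def PosWord.raw {n : ℕ} (X : PosWord n) : RawWord := (X.map BandGen.raw).reverse

theorem PosWord.raw_append {n : ℕ} (X Y : PosWord n) :
    PosWord.raw (X ++ Y) = PosWord.raw Y ++ PosWord.raw X := by
  simp [PosWord.raw]

theorem PosWord.raw_injective {n : ℕ} : Function.Injective (PosWord.raw (n := n)) :=
  List.reverse_injective.comp (List.map_injective_iff.2 BandGen.raw_injective)

theorem PosWord.eq_append_of_raw_eq {n : ℕ} {X : PosWord n} {U V : RawWord}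
    (h : PosWord.raw X = U ++ V) :
    ∃ X₁ X₂ : PosWord n, X = X₁ ++ X₂ ∧ PosWord.raw X₂ = U ∧ PosWord.raw X₁ = V := by
  rw [PosWord.raw, List.reverse_eq_iff, List.reverse_append, List.map_eq_append_iff] at h
  obtain ⟨X₁, X₂, rfl, h₁, h₂⟩ := h
  exact ⟨X₁, X₂, rfl, by simp [PosWord.raw, h₂], by simp [PosWord.raw, h₁]⟩

/-- For two chords, the sign condition says that they are disjoint and do not cross. -/
theorem noncrossing_iff {t s r q : ℕ} (hts : s < t) (hrq : q < r) :
    0 < ((t : ℤ) - r) * ((t : ℤ) - q) * ((s : ℤ) - r) * ((s : ℤ) - q) ↔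
      t < q ∨ r < s ∨ (s < q ∧ r < t) ∨ (q < s ∧ t < r) := by
  simp only [mul_pos_iff, mul_neg_iff, sub_pos, sub_neg, Nat.cast_lt]
  omega

theorem BandRel.raw {n : ℕ} {U V : PosWord n} (h : BandRel n U V) :
    RawEquiv (PosWord.raw U) (PosWord.raw V) := by
  rcases h with ⟨t, s, r, q, hts, hrq, h⟩ | ⟨t, s, r, h⟩ | ⟨t, s, r, h⟩ | ⟨t, s, r, h⟩
  · rw [noncrossing_iff hts.2.1 hrq.2.1] at h
    exact .of_rel (.comm r q t s hrq.2.1 hts.2.1 (by omega))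
  · exact .of_rel (.triangle₁ t s r ⟨h.2.1, h.2.2.1⟩)
  · exact .of_rel (.triangle₂ t s r ⟨h.2.1, h.2.2.1⟩)
  · exact .of_rel (.triangle₃ t s r ⟨h.2.1, h.2.2.1⟩)

theorem PosEquiv.raw {n : ℕ} {X Y : PosWord n} (h : X ≐ Y) :
    RawEquiv (PosWord.raw X) (PosWord.raw Y) := by
  induction h with
  | refl => exact RawEquiv.refl _
  | tail _ h ih =>
    obtain ⟨P, U, V, S, h, rfl, rfl⟩ := h
    refine ih.trans ?_
    simp only [PosWord.raw_append]
    exact ((h.elim BandRel.raw fun h => h.raw.symm).append_right _).append_left _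

theorem BandGen.eq_band_of_raw_eq {n : ℕ} {a : BandGen n} {t s : ℕ} (h : a.raw = (t, s)) :
    ∃ h, a = band t s h := by
  cases h
  exact ⟨⟨a.one_le, a.lt, a.le⟩, rfl⟩

theorem PosWord.eq_of_raw_eq_pair {n : ℕ} {X : PosWord n} {t s r q : ℕ}
    (h : PosWord.raw X = [(r, q), (t, s)]) : ∃ h h', X = [band t s h, band r q h'] := by
  rw [PosWord.raw, List.reverse_eq_iff] at h
  match X, h with
  | [x, y], h =>
    simp only [List.map_cons, List.map_nil, List.reverse_cons, List.reverse_nil, List.nil_append,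
      List.cons_append, List.cons.injEq, and_true] at h
    obtain ⟨hx, rfl⟩ := BandGen.eq_band_of_raw_eq h.1
    obtain ⟨hy, rfl⟩ := BandGen.eq_band_of_raw_eq h.2
    exact ⟨hx, hy, rfl⟩

/-- Both sides of each relation involve the same subscripts, so the bounds `1` and `n` survive. -/
theorem RawRel.exists_posWord {n : ℕ} {U V : RawWord} (h : RawRel U V ∨ RawRel V U)
    {X : PosWord n} (hX : PosWord.raw X = U) :
    ∃ Y : PosWord n, PosWord.raw Y = V ∧ (BandRel n X Y ∨ BandRel n Y X) := by
  rcases h with h | h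
  · cases h with
    | comm t s r q hts hrq h =>
      obtain ⟨h₁, h₂, rfl⟩ := PosWord.eq_of_raw_eq_pair hX
      exact ⟨[band t s, band r q], rfl, .inl (.comm _ _ _ _ _ _
        ((noncrossing_iff hrq hts).2 (by omega)))⟩
    | triangle₁ t s r h =>
      obtain ⟨h₁, h₂, rfl⟩ := PosWord.eq_of_raw_eq_pair hX
      exact ⟨[band t r, band t s], rfl, .inl (.triangle₁ t s r (by omega))⟩
    | triangle₂ t s r h =>
      obtain ⟨h₁, h₂, rfl⟩ := PosWord.eq_of_raw_eq_pair hX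
      exact ⟨[band s r, band t r], rfl, .inl (.triangle₂ t s r (by omega))⟩
    | triangle₃ t s r h =>
      obtain ⟨h₁, h₂, rfl⟩ := PosWord.eq_of_raw_eq_pair hX
      exact ⟨[band s r, band t r], rfl, .inl (.triangle₃ t s r (by omega))⟩
  · cases h with
    | comm t s r q hts hrq h =>
      obtain ⟨h₁, h₂, rfl⟩ := PosWord.eq_of_raw_eq_pair hX
      exact ⟨[band r q, band t s], rfl, .inl (.comm _ _ _ _ _ _
        ((noncrossing_iff hts hrq).2 (by omega)))⟩
    | triangle₁ t s r h =>
      obtain ⟨h₁, h₂, rfl⟩ := PosWord.eq_of_raw_eq_pair hX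
      exact ⟨[band t s, band s r], rfl, .inr (.triangle₁ t s r (by omega))⟩
    | triangle₂ t s r h =>
      obtain ⟨h₁, h₂, rfl⟩ := PosWord.eq_of_raw_eq_pair hX
      exact ⟨[band t r, band t s], rfl, .inr (.triangle₂ t s r (by omega))⟩
    | triangle₃ t s r h =>
      obtain ⟨h₁, h₂, rfl⟩ := PosWord.eq_of_raw_eq_pair hX
      exact ⟨[band t s, band s r], rfl, .inr (.triangle₃ t s r (by omega))⟩

theorem RawEquiv.exists_posWord {n : ℕ} {X : PosWord n} {W : RawWord}
    (h : RawEquiv (PosWord.raw X) W) : ∃ Y : PosWord n, PosWord.raw Y = W ∧ X ≐ Y := by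
  induction h with
  | refl => exact ⟨X, rfl, Relation.ReflTransGen.refl⟩
  | tail _ h ih =>
    obtain ⟨Y, hY, hXY⟩ := ih
    obtain ⟨P, U, V, S, h, rfl, rfl⟩ := h
    rw [List.append_assoc] at hY
    obtain ⟨Y₁, Y₂, rfl, rfl, hY₁⟩ := PosWord.eq_append_of_raw_eq hY
    obtain ⟨Y₃, Y₄, rfl, hU, rfl⟩ := PosWord.eq_append_of_raw_eq hY₁
    obtain ⟨T, rfl, hT⟩ := RawRel.exists_posWord h hU
    exact ⟨Y₃ ++ T ++ Y₂, by simp [PosWord.raw_append],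
      hXY.tail ⟨Y₃, Y₄, T, Y₂, hT, rfl, rfl⟩⟩

theorem PosEquiv.exists_common_prefix {n : ℕ} {a b : BandGen n} {X Y : PosWord n}
    (h : X ++ [a] ≐ Y ++ [b]) (U V : PosWord n) (hU : rightCompl a.raw b.raw = PosWord.raw U)
    (hV : rightCompl b.raw a.raw = PosWord.raw V) :
    ∃ Z : PosWord n, X ≐ Z ++ U ∧ Y ≐ Z ++ V := by
  have h := h.raw
  rw [PosWord.raw_append, PosWord.raw_append] at h
  obtain ⟨Z, hX, hY⟩ := cancelsBelow _ _ _ _ _ (Nat.lt_succ_self _) a.lt b.lt h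
  obtain ⟨X', hX', eX⟩ := hX.exists_posWord
  obtain ⟨Y', hY', eY⟩ := hY.exists_posWord
  obtain ⟨X₁, X₂, rfl, hX₂, rfl⟩ := PosWord.eq_append_of_raw_eq hX'
  obtain ⟨Y₁, Y₂, rfl, hY₂, hY₁⟩ := PosWord.eq_append_of_raw_eq hY'
  obtain rfl := PosWord.raw_injective hY₁
  obtain rfl := PosWord.raw_injective (hX₂.trans hU)
  obtain rfl := PosWord.raw_injective (hY₂.trans hV)
  exact ⟨Y₁, eX, eY⟩


theorem PosEquiv.symm {n : ℕ} {X Y : PosWord n} (h : X ≐ Y) : Y ≐ X := by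
  induction h with
  | refl => exact Relation.ReflTransGen.refl
  | tail _ h ih =>
    obtain ⟨P, U, V, S, h, rfl, rfl⟩ := h
    exact Relation.ReflTransGen.head ⟨P, V, U, S, h.symm, rfl, rfl⟩ ih

/-! ### Reading off the cases from `rightCompl`. -/

theorem mainTheorem7 (n t s r q : ℕ)
    (hts : 1 ≤ s ∧ s < t ∧ t ≤ n) (hrq : 1 ≤ q ∧ q < r ∧ r ≤ n)
    (X Y : PosWord n) (h : X ++ [band t s] ≐ Y ++ [band r q]) :
    -- (I)
    (t = r → s = q → X ≐ Y) ∧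
    -- (II)
    (∀ (_ : t = r) (_ : q < s),
      ∃ Z : PosWord n, X ≐ Z ++ [band t q] ∧ Y ≐ Z ++ [band s q]) ∧
    (∀ (_ : t = r) (_ : s < q),
      ∃ Z : PosWord n, X ≐ Z ++ [band q s] ∧ Y ≐ Z ++ [band t s]) ∧
    (∀ (_ : t = q),
      ∃ Z : PosWord n, X ≐ Z ++ [band r t] ∧ Y ≐ Z ++ [band r s]) ∧
    (∀ (_ : s = r),
      ∃ Z : PosWord n, X ≐ Z ++ [band t q] ∧ Y ≐ Z ++ [band t s]) ∧
    (∀ (_ : s = q) (_ : r < t),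
      ∃ Z : PosWord n, X ≐ Z ++ [band r s] ∧ Y ≐ Z ++ [band t r]) ∧
    (∀ (_ : s = q) (_ : t < r),
      ∃ Z : PosWord n, X ≐ Z ++ [band r t] ∧ Y ≐ Z ++ [band t s]) ∧
    -- (III)
    (0 < ((t : ℤ) - r) * ((t : ℤ) - q) * ((s : ℤ) - r) * ((s : ℤ) - q) →
      ∃ Z : PosWord n, X ≐ Z ++ [band r q] ∧ Y ≐ Z ++ [band t s]) ∧
    -- (IV)
    (∀ (_ : q < s) (_ : s < r) (_ : r < t),
      ∃ Z : PosWord n, X ≐ Z ++ [band t q, band r s] ∧ Y ≐ Z ++ [band t r, band s q]) ∧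
    (∀ (_ : s < q) (_ : q < t) (_ : t < r),
      ∃ Z : PosWord n, X ≐ Z ++ [band r t, band q s] ∧ Y ≐ Z ++ [band t q, band r s]) := by
  have key := fun U V => h.exists_common_prefix U V
  simp only [BandGen.raw, PosWord.raw, band] at key
  refine ⟨?_, ?_, ?_, ?_, ?_, ?_, ?_, fun hp => ?_, ?_, ?_⟩
  · rintro rfl rfl
    obtain ⟨Z, hX, hY⟩ := key [] [] (by simp [rightCompl]) (by simp [rightCompl])
    rw [List.append_nil] at hX hY
    exact Relation.ReflTransGen.trans hX hY.symm
  pick_goal 7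
  · rw [noncrossing_iff hts.2.1 hrq.2.1] at hp
    apply key <;> simp [rightCompl, BandGen.raw, band] <;> grind
  pick_goal 8
  · intro hsq hqt htr
    obtain ⟨Z, hX, hY⟩ := key [band r t, band q s] [band r s, band t q]
      (by simp [rightCompl, BandGen.raw, band]; grind)
      (by simp [rightCompl, BandGen.raw, band]; grind)
    -- The complement yields the two letters of `Y` in the opposite order; their chords are nested,
    -- so they commute.
    exact ⟨Z, hX, hY.tail ⟨Z, _, _, [], .inl (.comm r s t q (by omega) (by omega)
      ((noncrossing_iff (by omega) hqt).2 (by omega))), by simp, by simp⟩⟩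
  all_goals
    intros
    apply key <;> simp [rightCompl, BandGen.raw, band] <;> grind
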